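/- A digraph is a non-empty vertex set with an irreflexive, antisymmetric edge relation (no loops, and never both $xy$ and $yx$ are edges). It is connected if its underlying undirected graph is connected, locally finite if every vertex has only finitely many neighbours, and C-homogeneous if every isomorphism between two finite connected induced subdigraphs extends to an automorphism of the whole digraph. For a vertex $x$, $N^+(x)=\{y : xy \text{ is an edge}\}$ and $N^-(x)=\{y : yx \text{ is an edge}\}$, regarded as induced subdigraphs. $C_3$ is the directed cycle of length $3$, $\bar K_n$ is the digraph on $n$ vertices without edges, and $D[D']$ is the lexicographic product: its vertex set is $VD\times VD'$, and $(x,y)(x',y')$ is an edge if and only if $xx'\in ED$, or $x=x'$ and $yy'\in ED'$. Let $H$ be Lachlan's exceptional finite homogeneous digraph on $8$ vertices: its vertices are $s,t,u_i,l_i$ $(i\in\mathbb Z/3)$ and its edges are $su_i,\ u_it,\ tl_i,\ l_is,\ u_iu_{i+1},\ l_il_{i+1},\ l_iu_i,\ u_il_{i+1}$ for $i\in\mathbb Z/3$ (equivalently, $H$ is isomorphic to the digraph on $\mathbb F_3^2\setminus\{0\}$ with an edge from $v$ to $w$ whenever $\det(v,w)=1$). **Lemma 3.9.** Let $D$ be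 a connected locally finite C-homogeneous digraph, let $x\in VD$ and let $n\ge 1$ be an integer. If $N^+(x)\cong C_3[\bar K_n]$ or $N^-(x)\cong C_3[\bar K_n]$, then $D\cong H[\bar K_n]$. -/

import Mathlib

namespace Digraph

/-- The edge relation is asymmetric (equivalently, irreflexive and antisymmetric):
there are no loops and no edge is present in both directions. -/
def Asymmetric {V : Type*} (D : Digraph V) : Prop :=
  ∀ x y : V, D.Adj x y → ¬ D.Adj y x

/-- The out-neighbourhood of `x`. -/
def outNbhd {V : Type*} (D : Digraph V) (x : V) : Set V := {y | D.Adj x y}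

/-- The in-neighbourhood of `x`. -/
def inNbhd {V : Type*} (D : Digraph V) (x : V) : Set V := {y | D.Adj y x}

/-- Every vertex has only finitely many neighbours. -/
def IsLocallyFinite {V : Type*} (D : Digraph V) : Prop :=
  ∀ x : V, (D.outNbhd x ∪ D.inNbhd x).Finite

/-- A digraph is connected if its underlying undirected graph is connected
(in particular, it has a vertex). -/
def IsConnected {V : Type*} (D : Digraph V) : Prop :=
  D.toSimpleGraphInclusive.Connected

/-- The subdigraph induced by the vertex set `A`. -/
def inducedOn {V : Type*} (D : Digraph V) (A : Set V) : Digraph A where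
  Adj a b := D.Adj a b

/-- Isomorphisms of digraphs: bijections of the vertex sets that preserve and reflect edges. -/
abbrev Iso {V W : Type*} (D : Digraph V) (E : Digraph W) : Type _ := D.Adj ≃r E.Adj

/-- A digraph is C-homogeneous (connected-homogeneous) if every isomorphism between two finite
connected induced subdigraphs extends to an automorphism of the whole digraph. -/
def IsCHomogeneous {V : Type*} (D : Digraph V) : Prop :=
  ∀ A B : Set V, A.Finite → B.Finite →
    (D.inducedOn A).IsConnected → (D.inducedOn B).IsConnected →
    ∀ φ : Iso (D.inducedOn A) (D.inducedOn B),
      ∃ α : Iso D D, ∀ a : A, α (a : V) = (φ a : V)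

/-- The lexicographic product `D[E]`. -/
def lexProduct {V W : Type*} (D : Digraph V) (E : Digraph W) : Digraph (V × W) where
  Adj p q := D.Adj p.1 q.1 ∨ (p.1 = q.1 ∧ E.Adj p.2 q.2)

/-- The directed cycle of length `m`. -/
def directedCycle (m : ℕ) : Digraph (ZMod m) where
  Adj i j := j = i + 1

/-- The digraph on `n` vertices without edges. -/
def edgeless (n : ℕ) : Digraph (Fin n) := Digraph.emptyDigraph (Fin n)

/-- The eight vertices of Lachlan's exceptional finite homogeneous digraph: two poles and
two triples indexed by the integers modulo 3. -/
inductive LachlanVertex : Type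
  | north : LachlanVertex
  | south : LachlanVertex
  | upper : ZMod 3 → LachlanVertex
  | lower : ZMod 3 → LachlanVertex

/-- Lachlan's exceptional finite homogeneous digraph `H` on eight vertices. Both triples are
directed triangles; `north` dominates the upper triangle, which dominates `south`, which
dominates the lower triangle, which dominates `north`; and between the triangles there are the
edges `lower i → upper i` and `upper i → lower (i + 1)`. Every vertex is non-adjacent to exactly
one other vertex. (It is isomorphic to the digraph on the nonzero vectors of the plane over the
field with three elements with an edge from `u` to `v` whenever `det (u, v) = 1`.) -/
def lachlanH : Digraph LachlanVertex where
  Adj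
    | .north, .upper _ => True
    | .upper _, .south => True
    | .south, .lower _ => True
    | .lower _, .north => True
    | .upper i, .upper j => j = i + 1
    | .lower i, .lower j => j = i + 1
    | .lower i, .upper j => j = i
    | .upper i, .lower j => j = i + 1
    | _, _ => False

end Digraph

/-! By vertex-transitivity every out-neighbourhood is a `C₃[K̄ₙ]`. The colour class of `z` in
`N⁺(x)` does not depend on the in-neighbour `x` of `z` (`outClass_eq_outClass`), so its members are
twins (`twin_of_mem_outClass`). Twin classes therefore have size `n`, and `D` is the blow-up of its
twin quotient.

In the quotient, out-neighbourhoods are directed triangles, and transitivity on edges and on cyclic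
triangles leaves its trace as first-order conditions. These force the shape of `H` around any vertex
`x` (`nonempty_iso_lachlanH`): the triangle `y i` in `N⁺(x)` has a common out-neighbour `t`, and the
remaining out-neighbours `b i` of the `y i` form a triangle dominated by `t` and dominating `x`.
Connectedness excludes further vertices.

The case of `N⁻(x)` follows by reversing edges, as `C₃[K̄ₙ]` and `H` are isomorphic to their
reverses. -/

namespace Digraph

/-! ### Local structure when out-neighbourhoods are directed triangles. -/

section TriangularOutNeighbourhoods

variable {W : Type*} {D : Digraph W}

/-- The out-neighbours of every vertex are the vertices of a directed triangle. -/
def HasTriangleOutNbhds (D : Digraph W) : Prop :=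
  ∀ x, ∃ y : ZMod 3 → W, (∀ u, D.Adj x u ↔ ∃ i, u = y i) ∧ ∀ i, D.Adj (y i) (y (i + 1))

theorem Asymmetric.irrefl (h : D.Asymmetric) (x : W) : ¬ D.Adj x x :=
  fun hx => h x x hx hx

theorem zmod_three_cases (i j : ZMod 3) : j = i ∨ j = i + 1 ∨ j = i + 1 + 1 := by
  revert i j; decide

theorem zmod_three_add (i : ZMod 3) : i + 1 + 1 + 1 = i := by
  revert i; decide

theorem HasTriangleOutNbhds.exists_cycle (h : D.HasTriangleOutNbhds) {x y : W}
    (hxy : D.Adj x y) : ∃ z w, D.Adj x z ∧ D.Adj x w ∧ D.Adj y z ∧ D.Adj z w ∧ D.Adj w y ∧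
      ∀ u, D.Adj x u → u = y ∨ u = z ∨ u = w := by
  obtain ⟨c, hc, hcyc⟩ := h x
  obtain ⟨i, rfl⟩ := (hc y).1 hxy
  refine ⟨c (i + 1), c (i + 1 + 1), (hc _).2 ⟨_, rfl⟩, (hc _).2 ⟨_, rfl⟩, hcyc _, hcyc _, ?_, ?_⟩
  · simpa only [zmod_three_add] using hcyc (i + 1 + 1)
  · intro u hu
    obtain ⟨j, rfl⟩ := (hc u).1 hu
    rcases zmod_three_cases i j with rfl | rfl | rfl <;> simp

theorem HasTriangleOutNbhds.unique_common_out (h : D.HasTriangleOutNbhds) (ha : D.Asymmetric)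
    {x y z z' : W} (hxy : D.Adj x y) (hxz : D.Adj x z) (hyz : D.Adj y z) (hxz' : D.Adj x z')
    (hyz' : D.Adj y z') : z = z' := by
  obtain ⟨p, q, -, -, -, -, hqy, hall⟩ := h.exists_cycle hxy
  have key : ∀ u, D.Adj x u → D.Adj y u → u = p := by
    intro u hu hyu
    rcases hall u hu with rfl | rfl | rfl
    · exact (ha.irrefl _ hyu).elim
    · rfl
    · exact (ha _ _ hqy hyu).elim
  rw [key z hxz hyz, key z' hxz' hyz']

theorem HasTriangleOutNbhds.unique_middle (h : D.HasTriangleOutNbhds) (ha : D.Asymmetric)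
    {x y y' z : W} (hxz : D.Adj x z) (hxy : D.Adj x y) (hyz : D.Adj y z) (hxy' : D.Adj x y')
    (hyz' : D.Adj y' z) : y = y' := by
  obtain ⟨p, q, -, -, hzp, -, -, hall⟩ := h.exists_cycle hxz
  have key : ∀ u, D.Adj x u → D.Adj u z → u = q := by
    intro u hu huz
    rcases hall u hu with rfl | rfl | rfl
    · exact (ha.irrefl _ huz).elim
    · exact (ha _ _ hzp huz).elim
    · rfl
  rw [key y hxy hyz, key y' hxy' hyz']

/-- Send each in-neighbour `p` of `y` to the unique `q` with `p → q → y`. This self-map of a finite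
set is onto by `hcom`, hence injective. -/
theorem HasTriangleOutNbhds.unique_common_in (h : D.HasTriangleOutNbhds) (ha : D.Asymmetric)
    (hfin : ∀ y, (D.inNbhd y).Finite)
    (hcom : ∀ p y, D.Adj p y → ∃ v, D.Adj v p ∧ D.Adj v y)
    {p y v v' : W} (hpy : D.Adj p y) (hvp : D.Adj v p) (hvy : D.Adj v y)
    (hvp' : D.Adj v' p) (hvy' : D.Adj v' y) : v = v' := by
  have hmid : ∀ p : D.inNbhd y, ∃ q : D.inNbhd y, D.Adj p q := by
    rintro ⟨p, hp⟩
    obtain ⟨z, w, -, hw, -, -, hwy, -⟩ := h.exists_cycle hp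
    exact ⟨⟨w, hwy⟩, hw⟩
  choose σ hσ using hmid
  have : Finite (D.inNbhd y) := hfin y
  have hval : ∀ (v : W) (hv : D.Adj v y) (p : W) (hp : D.Adj p y), D.Adj v p →
      σ ⟨v, hv⟩ = ⟨p, hp⟩ := fun v hv p hp hvp =>
    Subtype.ext (h.unique_middle ha hv (hσ ⟨v, hv⟩) (σ ⟨v, hv⟩).2 hvp hp)
  have hsurj : Function.Surjective σ := by
    rintro ⟨p, hp⟩
    obtain ⟨v, hvp, hvy⟩ := hcom p y hp
    exact ⟨⟨v, hvy⟩, hval v hvy p hp hvp⟩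
  have hinj := Finite.injective_iff_surjective.2 hsurj
  exact congrArg Subtype.val (hinj ((hval v hvy p hpy hvp).trans (hval v' hvy' p hpy hvp').symm))

theorem HasTriangleOutNbhds.adj_of_path (h : D.HasTriangleOutNbhds) (ha : D.Asymmetric)
    {x u v w : W} (hu : D.Adj x u) (hv : D.Adj x v) (hw : D.Adj x w) (huv : D.Adj u v)
    (hvw : D.Adj v w) : D.Adj w u ∧ ∀ z, D.Adj x z → z = u ∨ z = v ∨ z = w := by
  obtain ⟨p, q, hp, hq, hup, hpq, hqu, hall⟩ := h.exists_cycle hu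
  obtain rfl := h.unique_common_out ha hu hp hup hv huv
  obtain rfl := h.unique_common_out ha hp hq hpq hw hvw
  exact ⟨hqu, hall⟩

theorem HasTriangleOutNbhds.adj_or_adj (h : D.HasTriangleOutNbhds)
    {x u v : W} (hu : D.Adj x u) (hv : D.Adj x v) (huv : u ≠ v) : D.Adj u v ∨ D.Adj v u := by
  obtain ⟨p, q, -, -, hup, -, hqu, hall⟩ := h.exists_cycle hu
  rcases hall v hv with rfl | rfl | rfl
  · exact (huv rfl).elim
  · exact .inl hup
  · exact .inr hqu

/-- In the triangle `N⁺(v)` the only alternative is `a → w`. Then `u, a, w` is a cyclic triangle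
with a common in-neighbour, which must be `x` because the edge `w → u` has only one; so `a` lies in
`N⁺(x) = {u, v, w}`, which is absurd. -/
theorem HasTriangleOutNbhds.third_adj (h : D.HasTriangleOutNbhds) (ha : D.Asymmetric)
    (hfin : ∀ y, (D.inNbhd y).Finite)
    (hcom : ∀ p y, D.Adj p y → ∃ v, D.Adj v p ∧ D.Adj v y)
    (htri : ∀ u v w, D.Adj u v → D.Adj v w → D.Adj w u →
      ∃ x, D.Adj x u ∧ D.Adj x v ∧ D.Adj x w)
    {x u v w a : W} (hu : D.Adj x u) (hv : D.Adj x v) (hw : D.Adj x w) (huv : D.Adj u v)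
    (hvw : D.Adj v w) (hua : D.Adj u a) (hva : D.Adj v a) : D.Adj w a := by
  obtain ⟨hwu, hall⟩ := h.adj_of_path ha hu hv hw huv hvw
  obtain ⟨p, q, -, -, hwp, -, hqw, hall'⟩ := h.exists_cycle hvw
  rcases hall' a hva with rfl | rfl | rfl
  · exact (ha _ _ hwu hua).elim
  · exact hwp
  · obtain ⟨x', hx'u, hx'a, hx'w⟩ := htri u a w hua hqw hwu
    obtain rfl := h.unique_common_in ha hfin hcom hwu hw hu hx'w hx'u
    rcases hall a hx'a with rfl | rfl | rfl
    · exact (ha.irrefl _ hua).elim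
    · exact (ha.irrefl _ hva).elim
    · exact (ha.irrefl _ hqw).elim

end TriangularOutNeighbourhoods

/-! ### Recognition of `H`. -/

section LachlanRecognition

/-- Each vertex of `H` has exactly one non-neighbour besides itself, so `q` cannot miss both ends of
an edge. This is what makes homomorphisms out of `H` reflect edges below. -/
theorem lachlanH_cases {p r : LachlanVertex} (q : LachlanVertex) (h : lachlanH.Adj p r) :
    q = r ∨ lachlanH.Adj q r ∨ lachlanH.Adj r q ∨ lachlanH.Adj p q ∨ lachlanH.Adj q p := by
  rcases p with _ | _ | i | i <;> rcases r with _ | _ | j | j <;>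
    rcases q with _ | _ | k | k <;> simp [lachlanH] at h ⊢
  all_goals
    try revert i
    try revert j
    try revert k
    decide

theorem lachlanH_twinFree {p q : LachlanVertex}
    (h : ∀ r, lachlanH.Adj p r ↔ lachlanH.Adj q r) : p = q := by
  have hn := h .north
  have hs := h .south
  have hu := fun j => h (.upper j)
  have hl := fun j => h (.lower j)
  clear h
  rcases p with _ | _ | i | i <;> rcases q with _ | _ | j | j <;>
    simp [lachlanH] at hn hs hu hl ⊢
  all_goals exact hu

variable {W : Type*} {D : Digraph W}

/-- A homomorphism from `lachlanH` whose image is closed under taking neighbours is an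
isomorphism. -/
theorem nonempty_iso_lachlanH_of_hom (ha : D.Asymmetric)
    (hconn : ∀ S : Set W, S.Nonempty → (∀ u v, u ∈ S → (D.Adj u v ∨ D.Adj v u) → v ∈ S) →
      S = Set.univ)
    (hcyc : ∀ p q, D.Adj p q → ∃ r, D.Adj q r ∧ D.Adj r p)
    (g : LachlanVertex → W) (hg : ∀ p q, lachlanH.Adj p q → D.Adj (g p) (g q))
    (hout : ∀ p w, D.Adj (g p) w → ∃ q, lachlanH.Adj p q ∧ w = g q) :
    Nonempty (Iso D lachlanH) := by
  have hiff : ∀ p q, D.Adj (g p) (g q) ↔ lachlanH.Adj p q := by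
    refine fun p q => ⟨fun h => ?_, hg p q⟩
    obtain ⟨r, hr, hqr⟩ := hout p _ h
    rcases lachlanH_cases q hr with rfl | h' | h' | h' | h'
    · exact hr
    · exact (ha.irrefl _ (hqr ▸ hg _ _ h')).elim
    · exact (ha.irrefl _ (hqr ▸ hg _ _ h')).elim
    · exact h'
    · exact (ha _ _ h (hg _ _ h')).elim
  have hinj : Function.Injective g := fun p q hpq =>
    lachlanH_twinFree fun r => by rw [← hiff, ← hiff, hpq]
  have hfwd : ∀ u v, u ∈ Set.range g → D.Adj u v → v ∈ Set.range g := by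
    rintro _ v ⟨p, rfl⟩ h
    obtain ⟨q, -, rfl⟩ := hout p v h
    exact ⟨q, rfl⟩
  have hsurj : Function.Surjective g := by
    rw [← Set.range_eq_univ]
    refine hconn _ ⟨_, .north, rfl⟩ fun u v hu huv => ?_
    rcases huv with huv | hvu
    · exact hfwd u v hu huv
    -- An in-neighbour is reached by two forward steps along a 3-cycle, so closure under
    -- out-neighbours suffices.
    · obtain ⟨r, hur, hrv⟩ := hcyc v u hvu
      exact hfwd r v (hfwd u r hu hur) hrv
  exact ⟨(⟨Equiv.ofBijective g ⟨hinj, hsurj⟩, fun {p q} => hiff p q⟩ : lachlanH.Adj ≃r D.Adj).symm⟩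

/-- Recognition of `lachlanH` among the digraphs whose out-neighbourhoods are directed
triangles. -/
theorem nonempty_iso_lachlanH [Nonempty W] (ha : D.Asymmetric) (h : D.HasTriangleOutNbhds)
    (hfin : ∀ y, (D.inNbhd y).Finite)
    (hconn : ∀ S : Set W, S.Nonempty → (∀ u v, u ∈ S → (D.Adj u v ∨ D.Adj v u) → v ∈ S) →
      S = Set.univ)
    (hcyc : ∀ p q, D.Adj p q → ∃ r, D.Adj q r ∧ D.Adj r p)
    (htri : ∀ u v w, D.Adj u v → D.Adj v w → D.Adj w u →
      ∃ x, D.Adj x u ∧ D.Adj x v ∧ D.Adj x w)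
    (hwheel : ∀ p z p' z', D.Adj p z → D.Adj p' z' →
      (∃ q r, D.Adj p q ∧ D.Adj q r ∧ D.Adj r p ∧ D.Adj q z ∧ D.Adj r z) →
      ∃ q r, D.Adj p' q ∧ D.Adj q r ∧ D.Adj r p' ∧ D.Adj q z' ∧ D.Adj r z') :
    Nonempty (Iso D lachlanH) := by
  have hcom : ∀ p y, D.Adj p y → ∃ v, D.Adj v p ∧ D.Adj v y := by
    intro p y hpy
    obtain ⟨r, hyr, hrp⟩ := hcyc p y hpy
    obtain ⟨v, hvp, hvy, -⟩ := htri p y r hpy hyr hrp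
    exact ⟨v, hvp, hvy⟩
  obtain ⟨x⟩ := ‹Nonempty W›
  obtain ⟨y, hxy, hy⟩ := h x
  have hxy' : ∀ i, D.Adj x (y i) := fun i => (hxy _).2 ⟨i, rfl⟩
  obtain ⟨t, -, hy0t, -, hy1t, -, -, -⟩ := h.exists_cycle (hy 0)
  have hyt : ∀ i, D.Adj (y i) t := by
    intro i
    rcases zmod_three_cases 0 i with rfl | rfl | rfl
    · exact hy0t
    · exact hy1t
    · exact h.third_adj ha hfin hcom htri (hxy' _) (hxy' _) (hxy' _) (hy 0) (hy _) hy0t hy1t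
  have hb : ∀ i, ∃ b, D.Adj (y i) b ∧ D.Adj t b ∧ D.Adj b (y (i + 1)) ∧
      ∀ u, D.Adj (y i) u → u = y (i + 1) ∨ u = t ∨ u = b := by
    intro i
    obtain ⟨p, b, hp, hb, hyp, hpb, hby, hall⟩ := h.exists_cycle (hy i)
    obtain rfl := h.unique_common_out ha (hy i) (hyt i) (hyt _) hp hyp
    exact ⟨b, hb, hpb, hby, hall⟩
  choose b hyb htb hby hally using hb
  have hbx : ∀ i, D.Adj (b i) x := by
    intro i
    -- The cycle on the `y`'s is a wheel for the edge `y 0 → t`; transported to `x → y (i + 1)`, its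
    -- other two vertices can only be `y i` and `b i`.
    obtain ⟨q, r, hxq, hqr, hrx, hqy, hry⟩ := hwheel (y 0) t x (y (i + 1)) (hyt 0) (hxy' _)
      ⟨y (0 + 1), y (0 + 1 + 1), hy _, hy _, by simpa only [zmod_three_add] using hy (0 + 1 + 1),
        hyt _, hyt _⟩
    obtain rfl := h.unique_middle ha (hxy' _) (hxy' i) (hy i) hxq hqy
    obtain rfl := h.unique_middle ha (hy i) (hyb i) (hby i) hqr hry
    exact hrx
  have hne : ∀ i, b i ≠ b (i + 1) := fun i hi => ha _ _ (hby i) (hi ▸ hyb (i + 1))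
  have hbb : ∀ i, D.Adj (b i) (b (i + 1)) := by
    intro i
    refine (h.adj_or_adj (htb i) (htb (i + 1)) (hne i)).resolve_right fun hi => ?_
    -- If `b (i + 1) → b i`, then `b i → x → y (i + 2)` is a path in `N⁺(b (i + 1))`, so it closes
    -- up: `y (i + 2) → b i`. No out-neighbour of `y (i + 2)` can equal `b i`.
    have hyb' := (h.adj_of_path ha hi (hbx _) (hby _) (hbx i) (hxy' _)).1
    have hi3 := zmod_three_add i
    rcases hally _ _ hyb' with h1 | h1 | h1
    · rw [hi3] at h1
      exact ha.irrefl (b i) (by simpa only [h1] using hyb i)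
    · exact ha.irrefl t (by simpa only [h1] using htb i)
    · exact hne (i + 1 + 1) (by rw [hi3, h1])
  let g : LachlanVertex → W
    | .north => x
    | .south => t
    | .upper i => y i
    -- The shift matches `upper i → lower (i + 1)` in `H` with `y i → b i`.
    | .lower i => b (i - 1)
  refine nonempty_iso_lachlanH_of_hom ha hconn hcyc g ?_ ?_
  · have hi : ∀ i : ZMod 3, i + 1 - 1 = i - 1 + 1 := by decide
    rintro (_ | _ | i | i) (_ | _ | j | j) hpq <;> simp only [lachlanH] at hpq <;> simp only [g]
    all_goals try subst hpq
    · exact hxy' _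
    · exact htb _
    · exact hyt _
    · exact hy _
    · simpa using hyb i
    · exact hbx _
    · simpa using hby (j - 1)
    · simpa only [hi] using hbb (i - 1)
  · rintro (_ | _ | i | i) w hw <;> simp only [g] at hw
    · obtain ⟨i, rfl⟩ := (hxy w).1 hw
      exact ⟨.upper i, trivial, rfl⟩
    · rcases (h.adj_of_path ha (htb 0) (htb _) (htb _) (hbb 0) (hbb _)).2 w hw with
        rfl | rfl | rfl
      · exact ⟨.lower 1, trivial, rfl⟩
      · exact ⟨.lower 2, trivial, rfl⟩
      · exact ⟨.lower 0, trivial, rfl⟩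
    · rcases hally i w hw with rfl | rfl | rfl
      · exact ⟨.upper (i + 1), rfl, rfl⟩
      · exact ⟨.south, trivial, rfl⟩
      · exact ⟨.lower (i + 1), rfl, by simp [g]⟩
    · rcases (h.adj_of_path ha (hbx _) (hby _) (hbb _) (hxy' _) (by simpa using hyb _)).2 w hw with
        rfl | rfl | rfl
      · exact ⟨.north, trivial, rfl⟩
      · exact ⟨.upper i, rfl, by simp [g]⟩
      · exact ⟨.lower (i + 1), rfl, by simp [g]⟩

end LachlanRecognition

end Digraph
namespace Digraph

/-! ### Transitivity on vertices, edges, cyclic triangles and induced cherries. -/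

section Homogeneity

variable {V : Type*} {D : Digraph V}

/-- An isomorphism between finite induced subdigraphs that contain a vertex adjacent to all others
extends to an automorphism of a C-homogeneous digraph. -/
theorem IsCHomogeneous.exists_aut (hhom : D.IsCHomogeneous) {ι : Type*} [Finite ι]
    {f g : ι → V} (hf : Function.Injective f) (hg : Function.Injective g)
    (hfg : ∀ i j, D.Adj (f i) (f j) ↔ D.Adj (g i) (g j)) (i₀ : ι)
    (hstar : ∀ i, i ≠ i₀ → D.Adj (f i) (f i₀) ∨ D.Adj (f i₀) (f i)) :
    ∃ α : Iso D D, ∀ i, α (f i) = g i := by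
  have hconn : ∀ h : ι → V, Function.Injective h →
      (∀ i, i ≠ i₀ → D.Adj (h i) (h i₀) ∨ D.Adj (h i₀) (h i)) →
      (D.inducedOn (Set.range h)).IsConnected := by
    intro h hh hs
    rw [IsConnected, SimpleGraph.connected_iff_exists_forall_reachable]
    refine ⟨⟨h i₀, i₀, rfl⟩, ?_⟩
    rintro ⟨_, i, rfl⟩
    by_cases hi : i = i₀
    · subst hi; exact SimpleGraph.Reachable.refl _
    · refine SimpleGraph.Adj.reachable ⟨fun he => hi ?_, (hs i hi).symm⟩
      exact (hh (congrArg Subtype.val he)).symm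
  have hstar' : ∀ i, i ≠ i₀ → D.Adj (g i) (g i₀) ∨ D.Adj (g i₀) (g i) := by
    intro i hi
    simpa only [← hfg] using hstar i hi
  let ef := Equiv.ofInjective f hf
  let eg := Equiv.ofInjective g hg
  let φ : Iso (D.inducedOn (Set.range f)) (D.inducedOn (Set.range g)) :=
    ⟨ef.symm.trans eg, by
      intro a b
      obtain ⟨i, rfl⟩ := ef.surjective a
      obtain ⟨j, rfl⟩ := ef.surjective b
      simp only [Equiv.trans_apply, Equiv.symm_apply_apply]
      exact (hfg i j).symm⟩
  obtain ⟨α, hα⟩ := hhom _ _ (Set.finite_range f) (Set.finite_range g) (hconn f hf hstar)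
    (hconn g hg hstar') φ
  refine ⟨α, fun i => ?_⟩
  refine (hα (ef i)).trans ?_
  simp only [φ, RelIso.coe_fn_mk, Equiv.trans_apply, Equiv.symm_apply_apply]
  rfl

theorem IsCHomogeneous.exists_aut_vertex (hhom : D.IsCHomogeneous) (ha : D.Asymmetric) (a b : V) :
    ∃ α : Iso D D, α a = b := by
  obtain ⟨α, hα⟩ := hhom.exists_aut (f := fun _ : Unit => a) (g := fun _ : Unit => b)
    (Function.injective_of_subsingleton _) (Function.injective_of_subsingleton _)
    (fun _ _ => iff_of_false (ha.irrefl _) (ha.irrefl _)) () (fun _ h => (h rfl).elim)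
  exact ⟨α, hα ()⟩

theorem IsCHomogeneous.exists_aut_edge (hhom : D.IsCHomogeneous) (ha : D.Asymmetric)
    {a b c d : V} (hab : D.Adj a b) (hcd : D.Adj c d) :
    ∃ α : Iso D D, α a = c ∧ α b = d := by
  have hinj : ∀ {a b : V}, D.Adj a b → Function.Injective ![a, b] := by
    intro a b h i j hij
    have hne : a ≠ b := fun e => ha.irrefl _ (e ▸ h)
    fin_cases i <;> fin_cases j <;> simp_all
  obtain ⟨α, hα⟩ := hhom.exists_aut (hinj hab) (hinj hcd)
    (by intro i j
        fin_cases i <;> fin_cases j <;>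
          simp [ha.irrefl, hab, hcd, ha _ _ hab, ha _ _ hcd]) 0
    (by intro i hi
        fin_cases i <;> simp_all)
  exact ⟨α, hα 0, hα 1⟩

theorem IsCHomogeneous.exists_aut_triangle (hhom : D.IsCHomogeneous) (ha : D.Asymmetric)
    {a b c a' b' c' : V} (hab : D.Adj a b) (hbc : D.Adj b c) (hca : D.Adj c a)
    (hab' : D.Adj a' b') (hbc' : D.Adj b' c') (hca' : D.Adj c' a') :
    ∃ α : Iso D D, α a = a' ∧ α b = b' ∧ α c = c' := by
  have hinj : ∀ {a b c : V}, D.Adj a b → D.Adj b c → D.Adj c a →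
      Function.Injective ![a, b, c] := by
    intro a b c h1 h2 h3 i j hij
    have h1 : a ≠ b := fun e => ha.irrefl _ (e ▸ h1)
    have h2 : b ≠ c := fun e => ha.irrefl _ (e ▸ h2)
    have h3 : c ≠ a := fun e => ha.irrefl _ (e ▸ h3)
    fin_cases i <;> fin_cases j <;> simp_all [eq_comm]
  obtain ⟨α, hα⟩ := hhom.exists_aut (hinj hab hbc hca) (hinj hab' hbc' hca')
    (by intro i j
        fin_cases i <;> fin_cases j <;>
          simp [ha.irrefl, hab, hbc, hca, hab', hbc', hca', ha _ _ hab, ha _ _ hbc, ha _ _ hca,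
            ha _ _ hab', ha _ _ hbc', ha _ _ hca']) 0
    (by intro i hi
        fin_cases i <;> simp_all)
  exact ⟨α, hα 0, hα 1, hα 2⟩

theorem IsCHomogeneous.exists_aut_cherry (hhom : D.IsCHomogeneous) (ha : D.Asymmetric)
    {a b c a' b' c' : V} (hac : D.Adj a c) (hbc : D.Adj b c) (hne : a ≠ b)
    (hab : ¬ D.Adj a b) (hba : ¬ D.Adj b a)
    (hac' : D.Adj a' c') (hbc' : D.Adj b' c') (hne' : a' ≠ b')
    (hab' : ¬ D.Adj a' b') (hba' : ¬ D.Adj b' a') :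
    ∃ α : Iso D D, α a = a' ∧ α b = b' ∧ α c = c' := by
  have hinj : ∀ {a b c : V}, D.Adj a c → D.Adj b c → a ≠ b →
      Function.Injective ![a, b, c] := by
    intro a b c h1 h2 h3 i j hij
    have h1 : a ≠ c := fun e => ha.irrefl _ (e ▸ h1)
    have h2 : b ≠ c := fun e => ha.irrefl _ (e ▸ h2)
    fin_cases i <;> fin_cases j <;> simp_all [eq_comm]
  obtain ⟨α, hα⟩ := hhom.exists_aut (hinj hac hbc hne) (hinj hac' hbc' hne')
    (by intro i j
        fin_cases i <;> fin_cases j <;>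
          simp [ha.irrefl, hac, hbc, hab, hba, hac', hbc', hab', hba', ha _ _ hac, ha _ _ hbc,
            ha _ _ hac', ha _ _ hbc']) 2
    (by intro i hi
        fin_cases i <;> simp_all)
  exact ⟨α, hα 0, hα 1, hα 2⟩

end Homogeneity

/-! ### Edge reversal. -/

section Reverse

variable {V W : Type*}

/-- The digraph with all edges reversed. -/
def reverse (D : Digraph V) : Digraph V where
  Adj x y := D.Adj y x

theorem Asymmetric.reverse {D : Digraph V} (h : D.Asymmetric) : D.reverse.Asymmetric :=
  fun x y hxy hyx => h x y hyx hxy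

theorem toSimpleGraphInclusive_reverse (D : Digraph V) :
    D.reverse.toSimpleGraphInclusive = D.toSimpleGraphInclusive := by
  ext x y
  exact and_congr_right fun _ => or_comm

theorem isConnected_reverse {D : Digraph V} : D.reverse.IsConnected ↔ D.IsConnected := by
  rw [IsConnected, toSimpleGraphInclusive_reverse, IsConnected]

theorem IsLocallyFinite.reverse {D : Digraph V} (h : D.IsLocallyFinite) :
    D.reverse.IsLocallyFinite := fun x => by
  rw [Set.union_comm]; exact h x

/-- An isomorphism of digraphs is also an isomorphism of the reversed digraphs. -/
def Iso.reverse {D : Digraph V} {E : Digraph W} (φ : Iso D E) : Iso D.reverse E.reverse :=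
  ⟨φ.toEquiv, fun {_ _} => φ.map_rel_iff⟩

theorem IsCHomogeneous.reverse {D : Digraph V} (h : D.IsCHomogeneous) :
    D.reverse.IsCHomogeneous := by
  intro A B hA hB hcA hcB φ
  obtain ⟨α, hα⟩ := h A B hA hB (isConnected_reverse.1 hcA) (isConnected_reverse.1 hcB)
    (Iso.reverse φ)
  exact ⟨α.reverse, hα⟩

/-- Lachlan's digraph is isomorphic to its reverse. -/
def lachlanHReverseIso : Iso lachlanH.reverse lachlanH where
  toFun
    | .north => .south
    | .south => .north
    | .upper i => .upper (-i)
    -- The offset `1` turns the reversed edges `upper i → lower i` into `upper (-i) → lower (-i +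
    -- 1)`.
    | .lower i => .lower (1 - i)
  invFun
    | .north => .south
    | .south => .north
    | .upper i => .upper (-i)
    | .lower i => .lower (1 - i)
  left_inv := by rintro (_ | _ | i | i) <;> simp
  right_inv := by rintro (_ | _ | i | i) <;> simp
  map_rel_iff' := by
    rintro (_ | _ | i | i) (_ | _ | j | j) <;> simp [lachlanH, reverse] <;>
      revert i j <;> decide

/-- A factor of a lexicographic product can be replaced by an isomorphic digraph. -/
def lexProductCongrLeft {U : Type*} {D : Digraph V} {E : Digraph W} (φ : Iso D E)
    (F : Digraph U) : Iso (D.lexProduct F) (E.lexProduct F) :=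
  ⟨φ.toEquiv.prodCongr (Equiv.refl U), by
    rintro ⟨a, i⟩ ⟨b, j⟩
    exact or_congr φ.map_rel_iff (and_congr_left' φ.toEquiv.apply_eq_iff_eq)⟩

theorem reverse_lexProduct_edgeless (D : Digraph V) (n : ℕ) :
    (D.lexProduct (edgeless n)).reverse = D.reverse.lexProduct (edgeless n) := by
  ext a b
  exact or_congr_right (iff_of_false (fun h => h.2) fun h => h.2)

end Reverse

/-! ### `C₃[K̄ₙ]` as a colouring by `ZMod 3`. -/

section Colouring

variable {V : Type*} {D : Digraph V} {n : ℕ}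

/-- The map `c` exhibits the subdigraph induced on `S` as `C₃[K̄ₙ]`. -/
structure IsBlowUpColouring (D : Digraph V) (n : ℕ) (S : Set V) (c : V → ZMod 3) : Prop where
  adj_iff : ∀ u ∈ S, ∀ v ∈ S, (D.Adj u v ↔ c v = c u + 1)
  ncard_class : ∀ i, {u ∈ S | c u = i}.ncard = n

theorem exists_isBlowUpColouring {S : Set V}
    (e : Iso (D.inducedOn S) (lexProduct (directedCycle 3) (edgeless n))) :
    ∃ c, D.IsBlowUpColouring n S c := by
  classical
  have hval : ∀ u : S, (if h : (u : V) ∈ S then (e ⟨u, h⟩).1 else 0) = (e u).1 := by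
    intro u
    rw [dif_pos u.2]
  -- The value `0` outside `S` is arbitrary: both conditions look only at `S`.
  refine ⟨fun u => if h : u ∈ S then (e ⟨u, h⟩).1 else 0, ?_, ?_⟩
  · intro u hu v hv
    have h1 := hval ⟨u, hu⟩
    have h2 := hval ⟨v, hv⟩
    simp only at h1 h2
    simp only [h1, h2]
    refine (e.map_rel_iff (a := ⟨u, hu⟩) (b := ⟨v, hv⟩)).symm.trans ?_
    exact or_iff_left fun h => h.2
  · intro i
    have : {u ∈ S | (if h : u ∈ S then (e ⟨u, h⟩).1 else 0) = i} =
        Set.range fun j : Fin n => (e.symm (i, j) : V) := by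
      ext u
      constructor
      · rintro ⟨hu, h⟩
        rw [dif_pos hu] at h
        refine ⟨(e ⟨u, hu⟩).2, ?_⟩
        subst h
        simp
      · rintro ⟨j, rfl⟩
        refine ⟨(e.symm (i, j)).2, ?_⟩
        rw [hval]
        simp
    rw [this, ← Set.image_univ, Set.ncard_image_of_injective, Set.ncard_univ, Nat.card_fin]
    intro j k hjk
    simpa using e.symm.injective (Subtype.ext hjk)

theorem IsBlowUpColouring.reverse {S : Set V} {c : V → ZMod 3} (h : D.IsBlowUpColouring n S c) :
    D.reverse.IsBlowUpColouring n S fun u => -c u := by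
  refine ⟨fun u hu v hv => (h.adj_iff v hv u hu).trans ?_, fun i => ?_⟩
  · generalize c u = a
    generalize c v = b
    revert a b; decide
  · simpa only [neg_eq_iff_eq_neg] using h.ncard_class (-i)

theorem IsBlowUpColouring.map {x : V} {c : V → ZMod 3}
    (h : D.IsBlowUpColouring n (D.outNbhd x) c) (α : Iso D D) :
    D.IsBlowUpColouring n (D.outNbhd (α x)) (c ∘ α.symm) := by
  have hmem : ∀ u, u ∈ D.outNbhd (α x) ↔ α.symm u ∈ D.outNbhd x := by
    intro u
    obtain ⟨u, rfl⟩ := α.surjective u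
    rw [α.symm_apply_apply]
    exact α.map_rel_iff
  refine ⟨fun u hu v hv => ?_, fun i => ?_⟩
  · exact α.symm.map_rel_iff.symm.trans (h.adj_iff _ ((hmem u).1 hu) _ ((hmem v).1 hv))
  · rw [← h.ncard_class i, ← Set.ncard_image_of_injective {u ∈ D.outNbhd x | c u = i} α.injective]
    congr 1
    ext u
    obtain ⟨u, rfl⟩ := α.surjective u
    rw [α.injective.mem_set_image]
    simp only [Set.mem_ofPred_eq, hmem, α.symm_apply_apply, Function.comp_apply]

end Colouring

end Digraph
namespace Digraph

/-! ### Blow-ups and twin classes. -/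

section TwinQuotient

variable {V : Type*} {D : Digraph V} {n : ℕ}

/-- Two vertices are twins if they have the same out-neighbours and the same in-neighbours. -/
def twinSetoid (D : Digraph V) : Setoid V where
  r z w := ∀ v, (D.Adj z v ↔ D.Adj w v) ∧ (D.Adj v z ↔ D.Adj v w)
  iseqv := ⟨fun _ _ => ⟨.rfl, .rfl⟩, fun h v => ⟨(h v).1.symm, (h v).2.symm⟩,
    fun h k v => ⟨(h v).1.trans (k v).1, (h v).2.trans (k v).2⟩⟩

/-- The digraph of twin classes. -/
def twinQuotient (D : Digraph V) : Digraph (Quotient D.twinSetoid) where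
  Adj := Quotient.lift₂ D.Adj fun _ b₁ a₂ _ h k => propext ((h b₁).1.trans (k a₂).2)

theorem twinQuotient_adj {x y : V} :
    D.twinQuotient.Adj (Quotient.mk _ x) (Quotient.mk _ y) ↔ D.Adj x y := Iff.rfl

theorem Asymmetric.twinQuotient (h : D.Asymmetric) : D.twinQuotient.Asymmetric := by
  rintro ⟨x⟩ ⟨y⟩
  exact h x y

/-- A digraph all of whose twin classes have `n` elements is a blow-up of its twin quotient. -/
theorem nonempty_iso_twinQuotient_lexProduct (hn : 1 ≤ n)
    (hcard : ∀ z, {w | D.twinSetoid w z}.ncard = n) :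
    Nonempty (Iso D (D.twinQuotient.lexProduct (edgeless n))) := by
  have he : ∀ q : Quotient D.twinSetoid, Nonempty ({v // Quotient.mk _ v = q} ≃ Fin n) := by
    refine Quotient.ind fun z => ?_
    have hset : {v | Quotient.mk D.twinSetoid v = Quotient.mk _ z} = {w | D.twinSetoid w z} :=
      Set.ext fun w => Quotient.eq
    have h : Nat.card {v // Quotient.mk D.twinSetoid v = Quotient.mk _ z} = n := by
      rw [← hcard z, ← hset]; rfl
    have : Finite {v // Quotient.mk D.twinSetoid v = Quotient.mk _ z} :=
      Nat.finite_of_card_ne_zero (by omega)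
    exact ⟨Finite.equivFinOfCardEq h⟩
  have e := fun q => (he q).some
  let E : V ≃ Quotient D.twinSetoid × Fin n :=
    (Equiv.sigmaFiberEquiv (Quotient.mk D.twinSetoid)).symm.trans
      ((Equiv.sigmaCongrRight e).trans (Equiv.sigmaEquivProd _ _))
  have hE : ∀ v, (E v).1 = Quotient.mk _ v := fun v => rfl
  refine ⟨⟨E, fun {a b} => ?_⟩⟩
  refine (or_iff_left fun h => h.2).trans ?_
  rw [hE, hE, twinQuotient_adj]

theorem IsConnected.eq_univ_of_closed (h : D.IsConnected) {S : Set V} (hS : S.Nonempty)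
    (hcl : ∀ u v, u ∈ S → (D.Adj u v ∨ D.Adj v u) → v ∈ S) : S = Set.univ := by
  obtain ⟨u, hu⟩ := hS
  refine Set.eq_univ_of_forall fun v => ?_
  obtain ⟨p⟩ := h.preconnected u v
  induction p with
  | nil => exact hu
  | cons hadj _ ih => exact ih (hcl _ _ hu hadj.2)

end TwinQuotient

/-! ### Colour classes are twin classes; the quotient is `H`. -/

section OutClasses

variable {V : Type*} {D : Digraph V} {n : ℕ} {c : V → V → ZMod 3}

/-- The out-neighbours of `x` that are not adjacent to `z`. -/
def outClass (D : Digraph V) (x z : V) : Set V := {w | D.Adj x w ∧ ¬ D.Adj w z ∧ ¬ D.Adj z w}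

theorem mem_outClass_self (ha : D.Asymmetric) {x z : V} (hxz : D.Adj x z) :
    z ∈ D.outClass x z := ⟨hxz, ha.irrefl z, ha.irrefl z⟩

theorem mem_outClass_comm {x z w : V} (hxz : D.Adj x z) (hw : w ∈ D.outClass x z) :
    z ∈ D.outClass x w := ⟨hxz, hw.2.2, hw.2.1⟩

theorem Iso.mem_outClass (α : Iso D D) {x z w : V} :
    α w ∈ D.outClass (α x) (α z) ↔ w ∈ D.outClass x z :=
  and_congr α.map_rel_iff (and_congr (not_congr α.map_rel_iff) (not_congr α.map_rel_iff))

theorem outClass_eq (hc : ∀ x, D.IsBlowUpColouring n (D.outNbhd x) (c x)) {x z : V}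
    (hxz : D.Adj x z) : D.outClass x z = {u ∈ D.outNbhd x | c x u = c x z} := by
  ext w
  refine and_congr_right fun hw => ?_
  rw [(hc x).adj_iff w hw z hxz, (hc x).adj_iff z hxz w hw]
  generalize c x w = a
  generalize c x z = b
  revert a b; decide

theorem ncard_outClass (hc : ∀ x, D.IsBlowUpColouring n (D.outNbhd x) (c x)) {x z : V}
    (hxz : D.Adj x z) : (D.outClass x z).ncard = n := by
  rw [outClass_eq hc hxz, (hc x).ncard_class]

theorem exists_colour (hn : 1 ≤ n) (hc : ∀ x, D.IsBlowUpColouring n (D.outNbhd x) (c x))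
    (x : V) (i : ZMod 3) : ∃ u, D.Adj x u ∧ c x u = i := by
  have h : {u ∈ D.outNbhd x | c x u = i}.Nonempty :=
    Set.nonempty_of_ncard_ne_zero (by rw [(hc x).ncard_class i]; omega)
  exact h

/-- In `N⁺(x)` the vertex `y` lies in the class preceding that of `z`, so it dominates the whole
class of `z`. Both sides have `n` elements. -/
theorem outClass_eq_of_adj (hn : 1 ≤ n) (hc : ∀ x, D.IsBlowUpColouring n (D.outNbhd x) (c x))
    {x y z : V} (hxy : D.Adj x y) (hxz : D.Adj x z) (hyz : D.Adj y z) :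
    D.outClass x z = D.outClass y z := by
  refine Set.eq_of_subset_of_ncard_le ?_ ?_ ?_
  · intro w hw
    refine ⟨((hc x).adj_iff y hxy w hw.1).2 ?_, hw.2⟩
    rw [outClass_eq hc hxz] at hw
    rw [hw.2, ← (hc x).adj_iff y hxy z hxz]
    exact hyz
  · rw [ncard_outClass hc hxz, ncard_outClass hc hyz]
  · exact Set.finite_of_ncard_ne_zero (by rw [ncard_outClass hc hyz]; omega)

/-- For non-adjacent `x ≠ x'` and `n ≥ 2`, two vertices `y, y'` of the class preceding `z` in
`N⁺(x)` induce the same class at `z`, both being adjacent from `x`. C-homogeneity maps the cherry `y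
→ z ← y'` to `x → z ← x'`. -/
theorem outClass_eq_outClass (ha : D.Asymmetric) (hhom : D.IsCHomogeneous) (hn : 1 ≤ n)
    (hc : ∀ x, D.IsBlowUpColouring n (D.outNbhd x) (c x))
    {x x' z : V} (hxz : D.Adj x z) (hxz' : D.Adj x' z) :
    D.outClass x z = D.outClass x' z := by
  by_cases h1 : D.Adj x x'
  · exact outClass_eq_of_adj hn hc h1 hxz hxz'
  by_cases h2 : D.Adj x' x
  · exact (outClass_eq_of_adj hn hc h2 hxz' hxz).symm
  by_cases h3 : x = x'
  · rw [h3]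
  rcases hn.eq_or_lt with rfl | hn2
  · obtain ⟨a, hA⟩ := Set.ncard_eq_one.1 (ncard_outClass hc hxz)
    obtain ⟨b, hB⟩ := Set.ncard_eq_one.1 (ncard_outClass hc hxz')
    have hza : z = a := by simpa only [hA, Set.mem_singleton_iff] using mem_outClass_self ha hxz
    have hzb : z = b := by simpa only [hB, Set.mem_singleton_iff] using mem_outClass_self ha hxz'
    rw [hA, hB, ← hza, ← hzb]
  · have hcard := (hc x).ncard_class (c x z - 1)
    obtain ⟨y, hy, y', hy', hne⟩ := (Set.one_lt_ncard (Set.finite_of_ncard_ne_zero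
      (by rw [hcard]; omega))).1 (by rw [hcard]; exact hn2)
    have hadj : ∀ u ∈ {u ∈ D.outNbhd x | c x u = c x z - 1}, D.Adj u z := fun u hu =>
      ((hc x).adj_iff u hu.1 z hxz).2 (by rw [hu.2]; ring)
    have hnadj : ∀ u ∈ {u ∈ D.outNbhd x | c x u = c x z - 1},
        ∀ v ∈ {u ∈ D.outNbhd x | c x u = c x z - 1}, ¬ D.Adj u v := by
      intro u hu v hv huv
      rw [(hc x).adj_iff u hu.1 v hv.1, hu.2, hv.2] at huv
      simp at huv
    obtain ⟨α, hα, hα', hαz⟩ := hhom.exists_aut_cherry ha (hadj y hy) (hadj y' hy') hne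
      (hnadj y hy y' hy') (hnadj y' hy' y hy) hxz hxz' h3 h1 h2
    have hcls : D.outClass y z = D.outClass y' z :=
      (outClass_eq_of_adj hn hc hy.1 hxz (hadj y hy)).symm.trans
        (outClass_eq_of_adj hn hc hy'.1 hxz (hadj y' hy'))
    ext w
    obtain ⟨u, rfl⟩ := α.surjective w
    have hu := (α.mem_outClass (x := y) (z := z) (w := u))
    have hu' := (α.mem_outClass (x := y') (z := z) (w := u))
    rw [hα, hαz] at hu
    rw [hα', hαz] at hu'
    rw [hu, hu', hcls]

theorem exists_common_in (ha : D.Asymmetric) (hhom : D.IsCHomogeneous) (hn : 1 ≤ n)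
    (hc : ∀ x, D.IsBlowUpColouring n (D.outNbhd x) (c x)) {z v : V} (hzv : D.Adj z v) :
    ∃ x, D.Adj x z ∧ D.Adj x v := by
  obtain ⟨a, hza, ha0⟩ := exists_colour hn hc z 0
  obtain ⟨b, hzb, hb1⟩ := exists_colour hn hc z 1
  have hab : D.Adj a b := ((hc z).adj_iff a hza b hzb).2 (by rw [ha0, hb1]; rfl)
  obtain ⟨α, hαa, hαb⟩ := hhom.exists_aut_edge ha hab hzv
  have h₁ : D.Adj (α z) (α a) := α.map_rel_iff.2 hza
  have h₂ : D.Adj (α z) (α b) := α.map_rel_iff.2 hzb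
  rw [hαa] at h₁
  rw [hαb] at h₂
  exact ⟨α z, h₁, h₂⟩

/-- In-neighbours agree because the class is the same from every in-neighbour of `z`. For an
out-neighbour `v` of `z`, compare colours inside `N⁺(x')`, with `x'` a common in-neighbour of `z`
and `v`. -/
theorem twin_of_mem_outClass (ha : D.Asymmetric) (hhom : D.IsCHomogeneous) (hn : 1 ≤ n)
    (hc : ∀ x, D.IsBlowUpColouring n (D.outNbhd x) (c x)) {x z w : V} (hxz : D.Adj x z)
    (hw : w ∈ D.outClass x z) : D.twinSetoid w z := by
  have hin : ∀ {x z w v : V}, D.Adj x z → w ∈ D.outClass x z → D.Adj v z → D.Adj v w := by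
    intro x z w v hxz hw hvz
    rw [outClass_eq_outClass ha hhom hn hc hxz hvz] at hw
    exact hw.1
  have hout : ∀ {x z w v : V}, D.Adj x z → w ∈ D.outClass x z → D.Adj z v → D.Adj w v := by
    intro x z w v hxz hw hzv
    obtain ⟨x', hxz', hxv'⟩ := exists_common_in ha hhom hn hc hzv
    rw [outClass_eq_outClass ha hhom hn hc hxz hxz', outClass_eq hc hxz'] at hw
    rw [(hc x').adj_iff w hw.1 v hxv', hw.2, ← (hc x').adj_iff z hxz' v hxv']
    exact hzv
  have hz := mem_outClass_comm hxz hw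
  exact fun v => ⟨⟨hout hw.1 hz, hout hxz hw⟩, ⟨hin hw.1 hz, hin hxz hw⟩⟩

theorem ncard_twins (ha : D.Asymmetric) (hhom : D.IsCHomogeneous) (hn : 1 ≤ n)
    (hc : ∀ x, D.IsBlowUpColouring n (D.outNbhd x) (c x)) (z : V) :
    {w | D.twinSetoid w z}.ncard = n := by
  obtain ⟨a, hza, -⟩ := exists_colour hn hc z 0
  obtain ⟨α, hα⟩ := hhom.exists_aut_vertex ha a z
  -- Vertex-transitivity supplies an in-neighbour of `z`.
  have hxz : D.Adj (α z) z := by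
    conv_rhs => rw [← hα]
    exact α.map_rel_iff.2 hza
  rw [← ncard_outClass hc hxz]
  congr 1
  ext w
  exact ⟨fun h => ⟨(h _).2.2 hxz, fun h' => ha.irrefl z ((h z).1.1 h'),
    fun h' => ha.irrefl z ((h z).2.1 h')⟩, twin_of_mem_outClass ha hhom hn hc hxz⟩

theorem hasTriangleOutNbhds_twinQuotient (ha : D.Asymmetric) (hhom : D.IsCHomogeneous)
    (hn : 1 ≤ n) (hc : ∀ x, D.IsBlowUpColouring n (D.outNbhd x) (c x)) :
    D.twinQuotient.HasTriangleOutNbhds := by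
  rintro ⟨x⟩
  choose y hxy hy using exists_colour hn hc x
  refine ⟨fun i => Quotient.mk _ (y i), ?_, fun i => ?_⟩
  · rintro ⟨u⟩
    refine ⟨fun hu => ⟨c x u, Quotient.sound ?_⟩, ?_⟩
    · refine twin_of_mem_outClass ha hhom hn hc (hxy _) ?_
      rw [outClass_eq hc (hxy _)]
      exact ⟨hu, (hy _).symm⟩
    · rintro ⟨i, hi⟩
      exact ((Quotient.exact hi _).2).2 (hxy i)
  · rw [twinQuotient_adj, (hc x).adj_iff _ (hxy _) _ (hxy _), hy, hy]

/-- A connected locally finite C-homogeneous digraph all of whose out-neighbourhoods are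
`C₃[K̄ₙ]` is isomorphic to `H[K̄ₙ]`. -/
theorem nonempty_iso_of_outNbhd (ha : D.Asymmetric) (hconn : D.IsConnected)
    (hfin : D.IsLocallyFinite) (hhom : D.IsCHomogeneous) (hn : 1 ≤ n) {x : V} {c₀ : V → ZMod 3}
    (hx : D.IsBlowUpColouring n (D.outNbhd x) c₀) :
    Nonempty (Iso D (lachlanH.lexProduct (edgeless n))) := by
  have hc : ∀ y, ∃ c, D.IsBlowUpColouring n (D.outNbhd y) c := by
    intro y
    obtain ⟨α, rfl⟩ := hhom.exists_aut_vertex ha x y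
    exact ⟨_, hx.map α⟩
  choose c hc using hc
  choose y hxy hy using exists_colour hn hc x
  have hyy : ∀ i, D.Adj (y i) (y (i + 1)) := fun i => by
    rw [(hc x).adj_iff _ (hxy _) _ (hxy _), hy, hy]
  have : Nonempty (Quotient D.twinSetoid) := ⟨Quotient.mk _ x⟩
  obtain ⟨φ⟩ := nonempty_iso_twinQuotient_lexProduct hn (ncard_twins ha hhom hn hc)
  obtain ⟨ψ⟩ : Nonempty (Iso D.twinQuotient lachlanH) := by
    refine nonempty_iso_lachlanH ha.twinQuotient
      (hasTriangleOutNbhds_twinQuotient ha hhom hn hc) ?_ ?_ ?_ ?_ ?_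
    · rintro ⟨v⟩
      refine (((hfin v).subset Set.subset_union_right).image (Quotient.mk D.twinSetoid)).subset ?_
      rintro ⟨u⟩ hu
      exact ⟨u, hu, rfl⟩
    · rintro S ⟨⟨u⟩, hu⟩ hS
      have := hconn.eq_univ_of_closed (S := Quotient.mk D.twinSetoid ⁻¹' S) ⟨u, hu⟩
        fun a b ha hab => hS _ _ ha hab
      refine Set.eq_univ_of_forall ?_
      rintro ⟨v⟩
      exact this.ge (Set.mem_univ v)
    · rintro ⟨p⟩ ⟨q⟩ hpq
      obtain ⟨α, rfl, rfl⟩ := hhom.exists_aut_edge ha (hyy 0) hpq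
      -- `hyy 2` closes the cycle, since `2` is `0 + 1 + 1` and `2 + 1` is `0` in `ZMod 3` by
      -- computation.
      exact ⟨Quotient.mk _ (α (y (0 + 1 + 1))), α.map_rel_iff.2 (hyy _), α.map_rel_iff.2 (hyy 2)⟩
    · rintro ⟨u⟩ ⟨v⟩ ⟨w⟩ huv hvw hwu
      obtain ⟨α, rfl, rfl, rfl⟩ := hhom.exists_aut_triangle ha (hyy 0) (hyy _) (hyy 2) huv hvw hwu
      exact ⟨Quotient.mk _ (α x), α.map_rel_iff.2 (hxy _), α.map_rel_iff.2 (hxy _),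
        α.map_rel_iff.2 (hxy _)⟩
    · rintro ⟨p⟩ ⟨z⟩ ⟨p'⟩ ⟨z'⟩ hpz hpz' ⟨⟨q⟩, ⟨r⟩, h1, h2, h3, h4, h5⟩
      obtain ⟨α, rfl, rfl⟩ := hhom.exists_aut_edge ha hpz hpz'
      exact ⟨Quotient.mk _ (α q), Quotient.mk _ (α r), α.map_rel_iff.2 h1, α.map_rel_iff.2 h2,
        α.map_rel_iff.2 h3, α.map_rel_iff.2 h4, α.map_rel_iff.2 h5⟩
  exact ⟨φ.trans (lexProductCongrLeft ψ _)⟩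

end OutClasses

end Digraph

theorem lemma3p9 {V : Type*} (D : Digraph V)
    (hasymm : D.Asymmetric) (hconn : D.IsConnected)
    (hfin : D.IsLocallyFinite) (hhom : D.IsCHomogeneous)
    (n : ℕ) (hn : 1 ≤ n) (x : V)
    (hx : Nonempty (Digraph.Iso (D.inducedOn (D.outNbhd x))
              (Digraph.lexProduct (Digraph.directedCycle 3) (Digraph.edgeless n))) ∨
          Nonempty (Digraph.Iso (D.inducedOn (D.inNbhd x))
              (Digraph.lexProduct (Digraph.directedCycle 3) (Digraph.edgeless n)))) :
    Nonempty (Digraph.Iso D (Digraph.lexProduct Digraph.lachlanH (Digraph.edgeless n))) := by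
  rcases hx with ⟨⟨e⟩⟩ | ⟨⟨e⟩⟩
  · obtain ⟨c, hc⟩ := Digraph.exists_isBlowUpColouring e
    exact Digraph.nonempty_iso_of_outNbhd hasymm hconn hfin hhom hn hc
  · obtain ⟨c, hc⟩ := Digraph.exists_isBlowUpColouring e
    obtain ⟨φ⟩ := Digraph.nonempty_iso_of_outNbhd (x := x) hasymm.reverse
      (Digraph.isConnected_reverse.2 hconn) hfin.reverse hhom.reverse hn hc.reverse
    have φ' := φ.reverse
    rw [Digraph.reverse_lexProduct_edgeless] at φ'
    exact ⟨φ'.trans (Digraph.lexProductCongrLeft Digraph.lachlanHReverseIso _)⟩
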